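/- **Theorem.** For $x\in\mathbb R$ let $$M(x)=\begin{pmatrix}1+x&1+x\\ 1&2+x\end{pmatrix},\qquad \mathcal M(x_1,\dots,x_n)=M(x_1)M(x_2)\cdots M(x_n).$$ Let $x_1,x_2,\dots$ be i.i.d. real random variables on a probability space, with a law supported on $[1/2,1]$. Let $\lambda_+$ and $\lambda_-$ denote the largest and the smallest eigenvalue of $\mathcal M(x_1,\dots,x_n)$; almost surely, for all $n$, these are real and positive, so that $$Y_n=\frac1n\log\frac{\lambda_+(\mathcal M(x_1,\dots,x_n))}{\lambda_-(\mathcal M(x_1,\dots,x_n))}\qquad(n\ge1)$$ is well defined, and $Y_n$ is integrable. Then the following hold. 1. (Concentration.) There is a constant $C>0$ such that for all $n\ge1$ and all $\varepsilon>0$ $$\mathbb P\big(Y_n-\mathbb E(Y_n)>\varepsilon\big)\le e^{-C\varepsilon^2n}\quad\text{and}\quad \mathbb P\big(Y_n-\mathbb E(Y_n)<-\varepsilon\big)\le e^{-C\varepsilon^2n}.$$ 2. There are (deterministic) real constants $L_+$ and $L_-$ such that, almost surely, $$\lim_{n\to\infty}\frac1n\log\lambda_\pm(\mathcal M(x_1,\dots,x_n))=L_\pm,$$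 and $L_++L_-=2\,\mathbb E\log(1+x_1)$. 3. Almost surely $\lim_{n\to\infty}Y_n=L_+-L_-$; moreover $\lim_{n\to\infty}\mathbb E(Y_n)=L_+-L_-$, and $$L_+-L_-\le\log\frac{\Lambda_+(\gamma)}{\Lambda_-(\gamma)},\qquad \gamma=\big(\mathbb E[(1+x_1)^{-1}]\big)^{-1}\in[3/2,2],$$ where $\Lambda_\pm(\gamma)=\frac{2\gamma+1\pm\sqrt{4\gamma+1}}2$ are the eigenvalues of $\begin{pmatrix}\gamma&\gamma\\1&1+\gamma\end{pmatrix}$. -/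

import Mathlib

open MeasureTheory ProbabilityTheory Filter Topology

noncomputable section

namespace TransferMatrix

/-- The one-step transfer matrix `M(x)`. -/
def M (x : ℝ) : Matrix (Fin 2) (Fin 2) ℝ :=
  !![1 + x, 1 + x; 1, 2 + x]

/-- The ordered product `M(x 0) * M(x 1) * ⋯ * M(x (n - 1))`; the term `x i` of the sequence
stands for the variable usually written `x_{i+1}`. -/
def prodM (x : ℕ → ℝ) (n : ℕ) : Matrix (Fin 2) (Fin 2) ℝ :=
  ((List.range n).map fun i => M (x i)).prod

/-- The largest real eigenvalue of a real matrix. -/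
def eigMax (A : Matrix (Fin 2) (Fin 2) ℝ) : ℝ := sSup (spectrum ℝ A)

/-- The smallest real eigenvalue of a real matrix. -/
def eigMin (A : Matrix (Fin 2) (Fin 2) ℝ) : ℝ := sInf (spectrum ℝ A)

/-- `Y_n = (1/n) log (λ₊ / λ₋)` for the product of the first `n` matrices. -/
def Y (x : ℕ → ℝ) (n : ℕ) : ℝ :=
  (1 / (n : ℝ)) * Real.log (eigMax (prodM x n) / eigMin (prodM x n))

/-- `Λ₊(γ)`, the larger eigenvalue of the matrix with rows `(γ, γ)` and `(1, 1 + γ)`. -/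
def LambdaPlus (γ : ℝ) : ℝ := (2 * γ + 1 + Real.sqrt (4 * γ + 1)) / 2

/-- `Λ₋(γ)`, the smaller eigenvalue of the matrix with rows `(γ, γ)` and `(1, 1 + γ)`. -/
def LambdaMinus (γ : ℝ) : ℝ := (2 * γ + 1 - Real.sqrt (4 * γ + 1)) / 2

end TransferMatrix

end

/-! Dividing `M x` by `1 + x` leaves a nonnegative matrix `unimodularM b`, `b = 1 / (1 + x)`, of
determinant 1. The product of `n` matrices is thus `∏ (1 + x i)` times a nonnegative unimodular
matrix with eigenvalues `ρ ≥ 1` and `1 / ρ`. Hence `log λ± = ∑ log (1 + x i) ± log ρ` and `Y_n = (2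
/ n) log ρ`; the sum obeys the strong law, and only `log ρ` needs work.

Concentration: `b` stays in `[1/2, 2/3]`, so changing one variable multiplies the entries by at most
`4/3`. The Perron root is monotone and homogeneous (`perron_le_mul`), so `log ρ` moves by at most
`log (4/3)`, and McDiarmid's inequality applies.

Limit: the entry sum is submultiplicative and lies between `ρ` and `6 ρ`. Fekete's lemma gives the
limit `l` of `E log ρ / n`; concentration and Borel–Cantelli make the convergence almost sure. Hence
`L± = E log (1 + x) ± l`.

Upper bound: by concavity of `log`, `E log` of the entry sum is at most the `log` of its mean. By
independence the mean matrix is the `n`-th power of `unimodularM β`, `β = E b = 1 / γ`, whose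
squared Perron root is `Λ₊(γ) / Λ₋(γ)`. -/

namespace TransferMatrix

open scoped NNReal

/-! ### McDiarmid's inequality -/

section BoundedDifferences

variable {E : Type*}

/-- A function of `n` variables that changes by at most `c` when one variable changes
oscillates by at most `n * c`. -/
theorem abs_sub_le_of_boundedDifferences {c : ℝ} {n : ℕ} {f : (Fin n → E) → ℝ}
    (hf : ∀ x i y, |f (Function.update x i y) - f x| ≤ c) (x y : Fin n → E) :
    |f x - f y| ≤ n * c := by
  classical
  -- Hybrid argument: pass from `y` to `x` one coordinate at a time.
  have key : ∀ s : Finset (Fin n), |f (s.piecewise x y) - f y| ≤ s.card * c := by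
    intro s
    induction s using Finset.induction_on with
    | empty => simp
    | insert j s hj ih =>
      rw [Finset.piecewise_insert, Finset.card_insert_of_notMem hj]
      push_cast
      have h1 := hf (s.piecewise x y) j (x j)
      have h2 := abs_sub_le (f (Function.update (s.piecewise x y) j (x j)))
        (f (s.piecewise x y)) (f y)
      linarith
  simpa using key Finset.univ

variable [MeasurableSpace E]

/-- **McDiarmid's inequality**, as a bound on the moment generating function. -/
theorem hasSubgaussianMGF_of_boundedDifferences (μ : Measure E) [IsProbabilityMeasure μ]
    {c : ℝ≥0} {n : ℕ} {f : (Fin n → E) → ℝ} (hfm : Measurable f)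
    (hf : ∀ x i y, |f (Function.update x i y) - f x| ≤ c) :
    HasSubgaussianMGF (fun x => f x - ∫ z, f z ∂Measure.pi fun _ => μ) (n * c ^ 2)
      (Measure.pi fun _ : Fin n => μ) := by
  induction n with
  | zero =>
    have : (fun x => f x - ∫ z, f z ∂Measure.pi fun _ => μ) = fun _ => 0 := by
      funext x
      have : f = fun _ => f x := funext fun z => congrArg f (Subsingleton.elim _ _)
      rw [this]; simp
    rw [this]
    simp
  | succ n ih =>
    have : Nonempty E := nonempty_of_isProbabilityMeasure μ
    let y₀ : E := Classical.arbitrary E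
    set π : Measure (Fin n → E) := Measure.pi fun _ => μ with hπ
    let e := MeasurableEquiv.piFinSuccAbove (fun _ : Fin (n + 1) => E) 0
    have he : MeasurePreserving e (Measure.pi fun _ => μ) (μ.prod π) :=
      measurePreserving_piFinSuccAbove (fun _ => μ) 0
    let F : E × (Fin n → E) → ℝ := fun p => f (e.symm p)
    have hFm : Measurable F := hfm.comp e.symm.measurable
    have hFf : F ∘ e = f := by funext x; simp [F]
    have hsymm : ∀ y x, e.symm (y, x) = Fin.cons y x := by
      intro y x
      simp [e, MeasurableEquiv.piFinSuccAbove, Fin.insertNthEquiv]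
    have hF1 : ∀ x y y', |F (y, x) - F (y', x)| ≤ c := by
      intro x y y'
      simp only [F, hsymm]
      have := hf (Fin.cons y' x) 0 y
      rwa [Fin.update_cons_zero] at this
    have hF2 : ∀ y x i z, |F (y, Function.update x i z) - F (y, x)| ≤ c := by
      intro y x i z
      simp only [F, hsymm]
      have := hf (Fin.cons y x) i.succ z
      rwa [← Fin.cons_update] at this
    have hbd : ∀ p, F p ∈ Set.Icc (F (y₀, fun _ => y₀) - (n + 1 : ℕ) * c)
        (F (y₀, fun _ => y₀) + (n + 1 : ℕ) * c) := by
      intro p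
      have := abs_le.1 (abs_sub_le_of_boundedDifferences hf (e.symm p)
        (e.symm (y₀, fun _ => y₀)))
      constructor <;> simp only [F] <;> linarith [this.1, this.2]
    have hFi : Integrable F (μ.prod π) :=
      Integrable.of_mem_Icc _ _ hFm.aemeasurable (ae_of_all _ hbd)
    have hFxi : ∀ x, Integrable (fun y => F (y, x)) μ := fun x =>
      Integrable.of_mem_Icc _ _ (hFm.comp measurable_prodMk_right).aemeasurable
        (ae_of_all _ fun y => hbd (y, x))
    -- Averaging over the first coordinate preserves bounded differences, so induction handles `g`,
    -- while Hoeffding's lemma handles `F - g` for fixed remaining coordinates.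
    let g : (Fin n → E) → ℝ := fun x => ∫ y, F (y, x) ∂μ
    have hgm : Measurable g :=
      (hFm.stronglyMeasurable.integral_prod_left' (μ := μ)).measurable
    have hg : ∀ x i z, |g (Function.update x i z) - g x| ≤ c := by
      intro x i z
      simp only [g]
      rw [← integral_sub (hFxi _) (hFxi _), ← Real.norm_eq_abs]
      have := norm_integral_le_of_norm_le_const (μ := μ) (C := (c : ℝ))
        (f := fun y => F (y, Function.update x i z) - F (y, x))
        (ae_of_all _ fun y => hF2 y x i z)
      simpa using this
    have hsub := ih hgm hg
    have hmean : ∫ z, f z ∂(Measure.pi fun _ => μ) = ∫ x, g x ∂π := by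
      rw [← integral_prod_symm _ hFi, ← he.integral_comp e.measurableEmbedding F]
      exact congrArg _ hFf.symm
    rw [hmean]
    set m := ∫ x, g x ∂π with hm
    have hHoeff : ∀ x t, ∫ y, Real.exp (t * (F (y, x) - g x)) ∂μ
        ≤ Real.exp ((c : ℝ) ^ 2 * t ^ 2 / 2) := by
      intro x t
      -- The interval centred at `F (y₀, x)` has length `2c`, so Hoeffding's lemma gives the
      -- parameter `(2c / 2)² = c²`.
      have h := hasSubgaussianMGF_of_mem_Icc (μ := μ) (X := fun y => F (y, x))
        (a := F (y₀, x) - c) (b := F (y₀, x) + c)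
        (hFm.comp measurable_prodMk_right).aemeasurable (ae_of_all _ fun y => by
          have := abs_le.1 (hF1 x y y₀)
          constructor <;> linarith [this.1, this.2])
      refine (h.mgf_le t).trans_eq ?_
      have : F (y₀, x) + c - (F (y₀, x) - c) = 2 * (c : ℝ) := by ring
      simp only [NNReal.coe_pow, NNReal.coe_div, coe_nnnorm, this, Real.norm_eq_abs]
      rw [abs_of_nonneg (by positivity)]
      simp
    have hint : ∀ t, Integrable (fun p => Real.exp (t * (F p - m))) (μ.prod π) := fun t =>
      integrable_exp_mul_of_mem_Icc (hFm.sub_const m).aemeasurable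
        (ae_of_all _ fun p => ⟨sub_le_sub_right (hbd p).1 m, sub_le_sub_right (hbd p).2 m⟩)
    have hprod : HasSubgaussianMGF (fun p => F p - m) ((n + 1 : ℕ) * c ^ 2) (μ.prod π) := by
      refine ⟨hint, fun t => ?_⟩
      calc mgf (fun p => F p - m) (μ.prod π) t
          = ∫ x, ∫ y, Real.exp (t * (F (y, x) - m)) ∂μ ∂π := integral_prod_symm _ (hint t)
        _ ≤ ∫ x, Real.exp (t * (g x - m)) * Real.exp ((c : ℝ) ^ 2 * t ^ 2 / 2) ∂π := by
          refine integral_mono (hint t).integral_prod_right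
            ((hsub.integrable_exp_mul t).mul_const _) fun x => ?_
          have : ∀ y, Real.exp (t * (F (y, x) - m))
              = Real.exp (t * (g x - m)) * Real.exp (t * (F (y, x) - g x)) := by
            intro y; rw [← Real.exp_add]; congr 1; ring
          simp only [this]
          rw [integral_const_mul]
          gcongr
          exact hHoeff x t
        _ ≤ Real.exp (((n * c ^ 2 : ℝ≥0) : ℝ) * t ^ 2 / 2)
              * Real.exp ((c : ℝ) ^ 2 * t ^ 2 / 2) := by
          rw [integral_mul_const]
          gcongr
          exact hsub.mgf_le t
        _ = _ := by
          rw [← Real.exp_add]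
          congr 1
          push_cast
          ring
    have := (he.map_eq ▸ hprod : HasSubgaussianMGF (fun p => F p - m) ((n + 1 : ℕ) * c ^ 2)
      ((Measure.pi fun _ => μ).map e)).of_map e.measurable.aemeasurable
    convert this using 2
    exact congrArg (· - m) (congrFun hFf.symm _)

end BoundedDifferences

/-! ### Perron roots of nonnegative 2 × 2 matrices -/

section Perron

/-- The larger root of the characteristic polynomial of a `2 × 2` matrix. -/
noncomputable def perron (A : Matrix (Fin 2) (Fin 2) ℝ) : ℝ :=
  (A.trace + Real.sqrt (A.trace ^ 2 - 4 * A.det)) / 2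

/-- The sum of the entries of a `2 × 2` matrix. -/
def entrySum (A : Matrix (Fin 2) (Fin 2) ℝ) : ℝ := A 0 0 + A 0 1 + A 1 0 + A 1 1

variable {A B : Matrix (Fin 2) (Fin 2) ℝ}

theorem disc_nonneg (hA : ∀ i j, 0 ≤ A i j) : 0 ≤ A.trace ^ 2 - 4 * A.det := by
  rw [Matrix.trace_fin_two, Matrix.det_fin_two]
  nlinarith [sq_nonneg (A 0 0 - A 1 1), mul_nonneg (hA 0 1) (hA 1 0)]

/-- By `h` the characteristic polynomial is nonnegative at `r`; the diagonal bounds put `r` to the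
right of its vertex, hence beyond the larger root. -/
theorem perron_le_of_le {r : ℝ} (h0 : A 0 0 ≤ r) (h1 : A 1 1 ≤ r)
    (h : A 0 1 * A 1 0 ≤ (r - A 0 0) * (r - A 1 1)) : perron A ≤ r := by
  have : Real.sqrt (A.trace ^ 2 - 4 * A.det) ≤ 2 * r - A.trace := by
    apply Real.sqrt_le_iff.2
    rw [Matrix.trace_fin_two, Matrix.det_fin_two]
    constructor <;> nlinarith
  rw [perron]
  linarith

theorem perron_sq (hA : ∀ i j, 0 ≤ A i j) :
    perron A ^ 2 = A.trace * perron A - A.det := by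
  have := Real.sq_sqrt (disc_nonneg hA)
  rw [perron]
  nlinarith

theorem le_perron (hA : ∀ i j, 0 ≤ A i j) (i : Fin 2) : A i i ≤ perron A := by
  have h : |A 0 0 - A 1 1| ≤ Real.sqrt (A.trace ^ 2 - 4 * A.det) := by
    apply Real.abs_le_sqrt
    rw [Matrix.trace_fin_two, Matrix.det_fin_two]
    nlinarith [mul_nonneg (hA 0 1) (hA 1 0)]
  have := abs_le.1 h
  rw [perron, Matrix.trace_fin_two] at *
  fin_cases i <;> simp only [Fin.zero_eta, Fin.mk_one] <;> linarith [this.1, this.2]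

/-- Monotonicity and homogeneity of the Perron root of nonnegative `2 × 2` matrices. -/
theorem perron_le_mul {K : ℝ} (hK : 0 ≤ K) (hA : ∀ i j, 0 ≤ A i j) (hB : ∀ i j, 0 ≤ B i j)
    (h : ∀ i j, A i j ≤ K * B i j) : perron A ≤ K * perron B := by
  have hB0 := le_perron hB 0
  have hB1 := le_perron hB 1
  have hsq := perron_sq hB
  rw [Matrix.trace_fin_two, Matrix.det_fin_two] at hsq
  have e0 : 0 ≤ K * (perron B - B 0 0) := mul_nonneg hK (by linarith)
  have e1 : 0 ≤ K * (perron B - B 1 1) := mul_nonneg hK (by linarith)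
  apply perron_le_of_le
  · linarith [h 0 0]
  · linarith [h 1 1]
  -- The characteristic equation of `B` reads `B 0 1 * B 1 0 = (perron B - B 0 0) * (perron B - B 1
  -- 1)`.
  · calc A 0 1 * A 1 0 ≤ (K * B 0 1) * (K * B 1 0) :=
        mul_le_mul (h 0 1) (h 1 0) (hA 1 0) (mul_nonneg hK (hB 0 1))
      _ = (K * (perron B - B 0 0)) * (K * (perron B - B 1 1)) := by linear_combination -K ^ 2 * hsq
      _ ≤ _ := mul_le_mul (by linarith [h 0 0]) (by linarith [h 1 1]) e1
        (by linarith [h 0 0])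

/-- The discriminant is nonnegative, so `trace² ≥ 4`, and the trace is nonnegative. -/
theorem two_le_trace (hA : ∀ i j, 0 ≤ A i j) (hdet : A.det = 1) : 2 ≤ A.trace := by
  have := disc_nonneg hA
  have h0 : 0 ≤ A.trace := by rw [Matrix.trace_fin_two]; exact add_nonneg (hA 0 0) (hA 1 1)
  nlinarith

theorem trace_le_two_mul_perron : A.trace ≤ 2 * perron A := by
  have := Real.sqrt_nonneg (A.trace ^ 2 - 4 * A.det)
  rw [perron]
  linarith

theorem one_le_perron (hA : ∀ i j, 0 ≤ A i j) (hdet : A.det = 1) : 1 ≤ perron A := by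
  linarith [two_le_trace hA hdet, trace_le_two_mul_perron (A := A)]

theorem perron_le_entrySum (hA : ∀ i j, 0 ≤ A i j) : perron A ≤ entrySum A := by
  have h00 := hA 0 0
  have h01 := hA 0 1
  have h10 := hA 1 0
  have h11 := hA 1 1
  rw [entrySum]
  apply perron_le_of_le <;> nlinarith

theorem entrySum_mul_le (hA : ∀ i j, 0 ≤ A i j) (hB : ∀ i j, 0 ≤ B i j) :
    entrySum (A * B) ≤ entrySum A * entrySum B := by
  simp only [entrySum, Matrix.mul_apply, Fin.sum_univ_two]
  have := fun i j k l => mul_nonneg (hA i j) (hB k l)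
  nlinarith [this 0 0 1 0, this 0 0 1 1, this 0 1 0 0, this 0 1 0 1, this 1 0 1 0,
    this 1 0 1 1, this 1 1 0 0, this 1 1 0 1]

theorem mul_entries_nonneg (hA : ∀ i j, 0 ≤ A i j) (hB : ∀ i j, 0 ≤ B i j) (i j : Fin 2) :
    0 ≤ (A * B) i j := by
  rw [Matrix.mul_apply]
  exact Finset.sum_nonneg fun k _ => mul_nonneg (hA i k) (hB k j)

/-- The real spectrum of `d • A` for a nonnegative unimodular `2 × 2` matrix `A`. -/
theorem spectrum_smul_eq (hA : ∀ i j, 0 ≤ A i j) (hdet : A.det = 1) (d : ℝ) :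
    spectrum ℝ (d • A) = {d * perron A, d * (perron A)⁻¹} := by
  have hp : 0 < perron A := by linarith [one_le_perron hA hdet]
  have hsq := perron_sq hA
  rw [hdet] at hsq
  have htr : A.trace = perron A + (perron A)⁻¹ := by
    field_simp
    linarith
  ext r
  rw [Matrix.mem_spectrum_iff_isRoot_charpoly, Matrix.charpoly_fin_two, Polynomial.IsRoot.def]
  simp only [Matrix.trace_smul, Matrix.det_smul, hdet, htr, Fintype.card_fin,
    Polynomial.eval_add, Polynomial.eval_sub, Polynomial.eval_pow, Polynomial.eval_mul,
    Polynomial.eval_X, Polynomial.eval_C, smul_eq_mul, Set.mem_insert_iff, Set.mem_singleton_iff]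
  rw [← sub_eq_zero (a := r) (b := d * perron A), ← sub_eq_zero (a := r) (b := d * (perron A)⁻¹),
    ← mul_eq_zero]
  have : (r - d * perron A) * (r - d * (perron A)⁻¹)
      = r ^ 2 - d * (perron A + (perron A)⁻¹) * r + d ^ 2 * 1 := by
    field_simp
    ring
  rw [this]

theorem isGreatest_spectrum_smul (hA : ∀ i j, 0 ≤ A i j) (hdet : A.det = 1) {d : ℝ}
    (hd : 0 ≤ d) : IsGreatest (spectrum ℝ (d • A)) (d * perron A) := by
  have hp := one_le_perron hA hdet
  rw [spectrum_smul_eq hA hdet]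
  refine ⟨by simp, ?_⟩
  rintro r (rfl | rfl)
  · exact le_rfl
  · exact mul_le_mul_of_nonneg_left ((inv_le_one_of_one_le₀ hp).trans hp) hd

theorem isLeast_spectrum_smul (hA : ∀ i j, 0 ≤ A i j) (hdet : A.det = 1) {d : ℝ}
    (hd : 0 ≤ d) : IsLeast (spectrum ℝ (d • A)) (d * (perron A)⁻¹) := by
  have hp := one_le_perron hA hdet
  rw [spectrum_smul_eq hA hdet]
  refine ⟨by simp, ?_⟩
  rintro r (rfl | rfl)
  · exact mul_le_mul_of_nonneg_left ((inv_le_one_of_one_le₀ hp).trans hp) hd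
  · exact le_rfl

end Perron

/-! ### The normalized product and its one-coordinate oscillation -/

section NormalizedProduct

/-- The unimodular matrix `M x / (1 + x)`, in terms of `b = 1 / (1 + x)`. -/
def unimodularM (b : ℝ) : Matrix (Fin 2) (Fin 2) ℝ := !![1, 1; b, 1 + b]

theorem M_eq_smul {x : ℝ} (hx : 1 + x ≠ 0) : M x = (1 + x) • unimodularM (1 + x)⁻¹ := by
  ext i j
  fin_cases i <;> fin_cases j <;> simp [M, unimodularM, hx]
  field_simp
  ring

theorem det_unimodularM (b : ℝ) : (unimodularM b).det = 1 := by
  simp [unimodularM, Matrix.det_fin_two]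

theorem unimodularM_nonneg {b : ℝ} (hb : 0 ≤ b) (i j : Fin 2) : 0 ≤ unimodularM b i j := by
  fin_cases i <;> fin_cases j <;> simp [unimodularM] <;> linarith

theorem unimodularM_le {b b' K : ℝ} (hK : 1 ≤ K) (h : b' ≤ K * b) (i j : Fin 2) :
    unimodularM b' i j ≤ K * unimodularM b i j := by
  fin_cases i <;> fin_cases j <;> simp [unimodularM] <;> linarith

/-- `1 / (1 + x)`, where `x` is first moved to the nearest point of `[1/2, 1]`. -/
noncomputable def clampInv (x : ℝ) : ℝ := (1 + max (1 / 2) (min x 1))⁻¹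

/-- Clamping makes these bounds hold at every real `x`, not just almost surely, as the pointwise
hypothesis of McDiarmid's inequality requires. -/
theorem clampInv_mem (x : ℝ) : clampInv x ∈ Set.Icc (1 / 2 : ℝ) (2 / 3) := by
  have h1 : (1 / 2 : ℝ) ≤ max (1 / 2) (min x 1) := le_max_left _ _
  have h2 : max (1 / 2 : ℝ) (min x 1) ≤ 1 := max_le (by norm_num) (min_le_right _ _)
  rw [clampInv]
  constructor
  · rw [le_inv_comm₀ (by norm_num) (by linarith)]; linarith
  · rw [inv_le_comm₀ (by linarith) (by norm_num)]; linarith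

theorem clampInv_nonneg (x : ℝ) : 0 ≤ clampInv x := by linarith [(clampInv_mem x).1]

theorem clampInv_of_mem {x : ℝ} (hx : x ∈ Set.Icc (1 / 2 : ℝ) 1) : clampInv x = (1 + x)⁻¹ := by
  rw [clampInv, min_eq_left hx.2, max_eq_right hx.1]

theorem measurable_clampInv : Measurable clampInv := by
  unfold clampInv
  fun_prop

/-- The normalized product of transfer matrices. -/
noncomputable def normProd {n : ℕ} (x : Fin n → ℝ) : Matrix (Fin 2) (Fin 2) ℝ :=
  (List.ofFn fun i => unimodularM (clampInv (x i))).prod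

theorem normProd_zero (x : Fin 0 → ℝ) : normProd x = 1 := by simp [normProd]

theorem normProd_succ {n : ℕ} (x : Fin (n + 1) → ℝ) :
    normProd x = unimodularM (clampInv (x 0)) * normProd (fun i => x i.succ) := by
  simp [normProd, List.ofFn_succ]

theorem normProd_nonneg {n : ℕ} (x : Fin n → ℝ) (i j : Fin 2) : 0 ≤ normProd x i j := by
  induction n generalizing i j with
  | zero => rw [normProd_zero]; fin_cases i <;> fin_cases j <;> simp
  | succ n ih =>
    rw [normProd_succ]
    exact mul_entries_nonneg (unimodularM_nonneg (clampInv_nonneg _)) (ih _) i j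

theorem det_normProd {n : ℕ} (x : Fin n → ℝ) : (normProd x).det = 1 := by
  induction n with
  | zero => simp [normProd_zero]
  | succ n ih => rw [normProd_succ, Matrix.det_mul, det_unimodularM, ih, one_mul]

theorem measurable_normProd {n : ℕ} (i j : Fin 2) :
    Measurable fun x : Fin n → ℝ => normProd x i j := by
  induction n generalizing i j with
  | zero => simp only [normProd_zero]; exact measurable_const
  | succ n ih =>
    simp only [normProd_succ, Matrix.mul_apply, Fin.sum_univ_two]
    have h : ∀ k l, Measurable fun x : Fin (n + 1) → ℝ => normProd (fun m => x m.succ) k l :=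
      fun k l => (ih k l).comp (by fun_prop)
    have h' : ∀ k l, Measurable fun x : Fin (n + 1) → ℝ => unimodularM (clampInv (x 0)) k l := by
      intro k l
      have hc : Measurable fun x : Fin (n + 1) → ℝ => clampInv (x 0) :=
        measurable_clampInv.comp (measurable_pi_apply 0)
      fin_cases k <;> fin_cases l <;> simp [unimodularM] <;> fun_prop
    exact ((h' _ _).mul (h _ _)).add ((h' _ _).mul (h _ _))

theorem normProd_append (x : ℕ → ℝ) (n m : ℕ) :
    normProd (fun i : Fin (n + m) => x i)
      = normProd (fun i : Fin n => x i) * normProd (fun i : Fin m => x (n + i)) := by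
  simp only [normProd]
  rw [List.ofFn_add, List.prod_append]
  simp

theorem prodM_eq_smul_normProd {x : ℕ → ℝ} (hx : ∀ i, x i ∈ Set.Icc (1 / 2 : ℝ) 1) (n : ℕ) :
    prodM x n = (∏ i ∈ Finset.range n, (1 + x i)) • normProd (fun i : Fin n => x i) := by
  induction n with
  | zero => simp [prodM, normProd_zero]
  | succ n ih =>
    have h : prodM x (n + 1) = prodM x n * M (x n) := by simp [prodM, List.range_succ]
    -- `prodM` grows on the right but `normProd_succ` peels from the left, so the last factor is
    -- split off as a block of length one.
    rw [h, ih, normProd_append x n 1, Finset.prod_range_succ,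
      M_eq_smul (by linarith [(hx n).1]), normProd_succ, normProd_zero]
    simp [clampInv_of_mem (hx n), smul_smul, mul_comm]

/-- The leftmost factor mixes the rows, so no off-diagonal entry can dominate. With `B` the product
of the other factors, `B 0 1` decides the constant: `1 + b ≤ 3 * b` exactly when `1/2 ≤ b`. -/
theorem entrySum_normProd_le {n : ℕ} (x : Fin n → ℝ) :
    entrySum (normProd x) ≤ 3 * (normProd x).trace := by
  cases n with
  | zero => simp [normProd_zero, entrySum]; norm_num
  | succ n =>
    have h := normProd_nonneg (fun i => x (Fin.succ i))
    have hb := clampInv_mem (x 0)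
    rw [normProd_succ, Matrix.trace_fin_two, entrySum]
    simp only [Matrix.mul_apply, Fin.sum_univ_two, unimodularM]
    simp
    set b := clampInv (x 0)
    nlinarith [h 0 0, h 0 1, h 1 0, h 1 1, hb.1, hb.2, mul_nonneg (sub_nonneg.2 hb.1) (h 0 0),
      mul_nonneg (sub_nonneg.2 hb.1) (h 0 1), mul_nonneg (sub_nonneg.2 hb.1) (h 1 0),
      mul_nonneg (sub_nonneg.2 hb.1) (h 1 1), mul_nonneg (sub_nonneg.2 hb.2) (h 0 0),
      mul_nonneg (sub_nonneg.2 hb.2) (h 0 1), mul_nonneg (sub_nonneg.2 hb.2) (h 1 0),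
      mul_nonneg (sub_nonneg.2 hb.2) (h 1 1)]

/-- One factor grows entrywise by at most `(2/3) / (1/2) = 4/3`, and multiplication by nonnegative
matrices preserves this. -/
theorem normProd_update_le {n : ℕ} (x : Fin n → ℝ) (k : Fin n) (y : ℝ) (i j : Fin 2) :
    normProd (Function.update x k y) i j ≤ 4 / 3 * normProd x i j := by
  induction n generalizing i j with
  | zero => exact k.elim0
  | succ n ih =>
    rw [normProd_succ, normProd_succ, Matrix.mul_apply, Matrix.mul_apply, Finset.mul_sum]
    refine Finset.sum_le_sum fun l _ => ?_
    refine Fin.cases ?_ (fun k => ?_) k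
    · simp only [Function.update_self]
      have h := unimodularM_le (b := clampInv (x 0)) (b' := clampInv y) (K := 4 / 3) (by norm_num)
        (by linarith [(clampInv_mem (x 0)).1, (clampInv_mem y).2]) i l
      have e : (fun m : Fin n => Function.update x 0 y m.succ) = fun m => x m.succ := by
        funext m; simp
      rw [e, ← mul_assoc]
      exact mul_le_mul_of_nonneg_right h (normProd_nonneg _ _ _)
    · have e : (fun m : Fin n => Function.update x k.succ y m.succ)
          = Function.update (fun m => x m.succ) k y :=
        Function.update_comp_eq_of_injective x (Fin.succ_injective n) k y
      rw [e, Function.update_of_ne (Fin.succ_ne_zero k).symm, mul_left_comm]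
      exact mul_le_mul_of_nonneg_left (ih _ k l j)
        (unimodularM_nonneg (clampInv_nonneg _) _ _)

/-- The logarithm of the Perron root of the normalized product. -/
noncomputable def logPerron {n : ℕ} (x : Fin n → ℝ) : ℝ := Real.log (perron (normProd x))

/-- The logarithm of the sum of the entries of the normalized product. -/
noncomputable def logSum {n : ℕ} (x : Fin n → ℝ) : ℝ := Real.log (entrySum (normProd x))

theorem measurable_entrySum_normProd {n : ℕ} :
    Measurable fun x : Fin n → ℝ => entrySum (normProd x) :=
  (((measurable_normProd 0 0).add (measurable_normProd 0 1)).add (measurable_normProd 1 0)).add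
    (measurable_normProd 1 1)

theorem measurable_logSum {n : ℕ} : Measurable (logSum (n := n)) :=
  Real.measurable_log.comp measurable_entrySum_normProd

theorem measurable_logPerron {n : ℕ} : Measurable (logPerron (n := n)) := by
  have h : Measurable fun x : Fin n → ℝ => (normProd x).trace := by
    simp only [Matrix.trace_fin_two]
    exact (measurable_normProd 0 0).add (measurable_normProd 1 1)
  unfold logPerron perron
  simp only [det_normProd]
  fun_prop

theorem one_le_perron_normProd {n : ℕ} (x : Fin n → ℝ) : 1 ≤ perron (normProd x) :=
  one_le_perron (normProd_nonneg x) (det_normProd x)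

theorem logPerron_update_le {n : ℕ} (x : Fin n → ℝ) (k : Fin n) (y : ℝ) :
    logPerron (Function.update x k y) ≤ logPerron x + Real.log (4 / 3) := by
  have h1 := one_le_perron_normProd x
  have h2 := one_le_perron_normProd (Function.update x k y)
  rw [logPerron, logPerron, add_comm, ← Real.log_mul (by norm_num) (by linarith)]
  exact Real.log_le_log (by linarith) (perron_le_mul (by norm_num) (normProd_nonneg _)
    (normProd_nonneg _) (normProd_update_le x k y))

theorem abs_logPerron_update_sub_le {n : ℕ} (x : Fin n → ℝ) (k : Fin n) (y : ℝ) :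
    |logPerron (Function.update x k y) - logPerron x| ≤ Real.log (4 / 3) := by
  have h1 := logPerron_update_le x k y
  -- Undoing the change gives the opposite inequality.
  have h2 := logPerron_update_le (Function.update x k y) k (x k)
  rw [Function.update_idem, Function.update_eq_self] at h2
  rw [abs_le]
  constructor <;> linarith

theorem logPerron_nonneg {n : ℕ} (x : Fin n → ℝ) : 0 ≤ logPerron x :=
  Real.log_nonneg (one_le_perron_normProd x)

theorem logPerron_le_logSum {n : ℕ} (x : Fin n → ℝ) : logPerron x ≤ logSum x :=
  Real.log_le_log (by linarith [one_le_perron_normProd x])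
    (perron_le_entrySum (normProd_nonneg x))

theorem entrySum_normProd_pos {n : ℕ} (x : Fin n → ℝ) : 0 < entrySum (normProd x) := by
  linarith [one_le_perron_normProd x, perron_le_entrySum (normProd_nonneg x)]

/-- `6 = 3 * 2`: the entry sum is at most three traces, the trace at most two Perron roots. -/
theorem logSum_le {n : ℕ} (x : Fin n → ℝ) : logSum x ≤ logPerron x + Real.log 6 := by
  have h1 := one_le_perron_normProd x
  rw [logPerron, logSum, add_comm, ← Real.log_mul (by norm_num) (by linarith)]
  refine Real.log_le_log (entrySum_normProd_pos x) ?_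
  linarith [entrySum_normProd_le x, trace_le_two_mul_perron (A := normProd x)]

/-- The reason for introducing `logSum`: Perron roots are not submultiplicative in general, entry
sums are. -/
theorem logSum_append_le (x : ℕ → ℝ) (n m : ℕ) :
    logSum (fun i : Fin (n + m) => x i)
      ≤ logSum (fun i : Fin n => x i) + logSum (fun i : Fin m => x (n + i)) := by
  rw [logSum, logSum, logSum,
    ← Real.log_mul (entrySum_normProd_pos _).ne' (entrySum_normProd_pos _).ne']
  refine Real.log_le_log (entrySum_normProd_pos _) ?_
  rw [normProd_append]
  exact entrySum_mul_le (normProd_nonneg _) (normProd_nonneg _)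

/-- A bound uniform in `x`, needed for integrability. -/
theorem logPerron_le {n : ℕ} (x : Fin n → ℝ) :
    logPerron x ≤ logPerron (fun _ : Fin n => (0 : ℝ)) + n * Real.log (4 / 3) := by
  have := abs_le.1 (abs_sub_le_of_boundedDifferences abs_logPerron_update_sub_le x fun _ => 0)
  linarith [this.2]

end NormalizedProduct

/-! ### Extreme eigenvalues along a fixed sequence -/

section Deterministic

theorem prod_one_add_pos {x : ℕ → ℝ} (hx : ∀ i, x i ∈ Set.Icc (1 / 2 : ℝ) 1) (n : ℕ) :
    0 < ∏ i ∈ Finset.range n, (1 + x i) :=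
  Finset.prod_pos fun i _ => by linarith [(hx i).1]

theorem isGreatest_spectrum_prodM {x : ℕ → ℝ} (hx : ∀ i, x i ∈ Set.Icc (1 / 2 : ℝ) 1) (n : ℕ) :
    IsGreatest (spectrum ℝ (prodM x n))
    ((∏ i ∈ Finset.range n, (1 + x i)) * perron (normProd fun i : Fin n => x i)) := by
  rw [prodM_eq_smul_normProd hx]
  exact isGreatest_spectrum_smul (normProd_nonneg _) (det_normProd _) (prod_one_add_pos hx n).le

theorem isLeast_spectrum_prodM {x : ℕ → ℝ} (hx : ∀ i, x i ∈ Set.Icc (1 / 2 : ℝ) 1) (n : ℕ) :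
    IsLeast (spectrum ℝ (prodM x n))
    ((∏ i ∈ Finset.range n, (1 + x i)) * (perron (normProd fun i : Fin n => x i))⁻¹) := by
  rw [prodM_eq_smul_normProd hx]
  exact isLeast_spectrum_smul (normProd_nonneg _) (det_normProd _) (prod_one_add_pos hx n).le

theorem eigMax_prodM {x : ℕ → ℝ} (hx : ∀ i, x i ∈ Set.Icc (1 / 2 : ℝ) 1) (n : ℕ) :
    eigMax (prodM x n)
    = (∏ i ∈ Finset.range n, (1 + x i)) * perron (normProd fun i : Fin n => x i) :=
  (isGreatest_spectrum_prodM hx n).csSup_eq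

theorem eigMin_prodM {x : ℕ → ℝ} (hx : ∀ i, x i ∈ Set.Icc (1 / 2 : ℝ) 1) (n : ℕ) :
    eigMin (prodM x n)
    = (∏ i ∈ Finset.range n, (1 + x i)) * (perron (normProd fun i : Fin n => x i))⁻¹ :=
  (isLeast_spectrum_prodM hx n).csInf_eq

theorem log_prod_one_add {x : ℕ → ℝ} (hx : ∀ i, x i ∈ Set.Icc (1 / 2 : ℝ) 1) (n : ℕ) :
    Real.log (∏ i ∈ Finset.range n, (1 + x i)) = ∑ i ∈ Finset.range n, Real.log (1 + x i) :=
  Real.log_prod fun i _ => by linarith [(hx i).1]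

theorem log_eigMax_prodM {x : ℕ → ℝ} (hx : ∀ i, x i ∈ Set.Icc (1 / 2 : ℝ) 1) (n : ℕ) :
    Real.log (eigMax (prodM x n))
    = ∑ i ∈ Finset.range n, Real.log (1 + x i) + logPerron fun i : Fin n => x i := by
  rw [eigMax_prodM hx, Real.log_mul (prod_one_add_pos hx n).ne'
    (by linarith [one_le_perron_normProd fun i : Fin n => x i]), log_prod_one_add hx, logPerron]

theorem log_eigMin_prodM {x : ℕ → ℝ} (hx : ∀ i, x i ∈ Set.Icc (1 / 2 : ℝ) 1) (n : ℕ) :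
    Real.log (eigMin (prodM x n))
    = ∑ i ∈ Finset.range n, Real.log (1 + x i) - logPerron fun i : Fin n => x i := by
  rw [eigMin_prodM hx, Real.log_mul (prod_one_add_pos hx n).ne'
    (inv_ne_zero (by linarith [one_le_perron_normProd fun i : Fin n => x i])), Real.log_inv,
    log_prod_one_add hx, logPerron, sub_eq_add_neg]

theorem Y_eq {x : ℕ → ℝ} (hx : ∀ i, x i ∈ Set.Icc (1 / 2 : ℝ) 1) (n : ℕ) :
    Y x n = 2 / n * logPerron fun i : Fin n => x i := by
  have hp := one_le_perron_normProd fun i : Fin n => x i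
  have hd := prod_one_add_pos hx n
  rw [Y, Real.log_div, log_eigMax_prodM hx, log_eigMin_prodM hx]
  · ring
  · rw [eigMax_prodM hx]; positivity
  · rw [eigMin_prodM hx]; positivity

end Deterministic

/-! ### The ratio of the eigenvalues of the averaged matrix -/

section LambdaRatio

theorem perron_unimodularM (b : ℝ) :
    perron (unimodularM b) = (2 + b + Real.sqrt ((2 + b) ^ 2 - 4)) / 2 := by
  rw [perron, det_unimodularM, Matrix.trace_fin_two]
  simp only [unimodularM, Matrix.of_apply, Matrix.cons_val', Matrix.cons_val_zero,
    Matrix.cons_val_one]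
  ring_nf

/-- The ratio `Λ₊(γ) / Λ₋(γ)` in terms of the normalized matrix. -/
theorem log_LambdaPlus_div_LambdaMinus {b : ℝ} (hb : 0 < b) :
    Real.log (LambdaPlus b⁻¹ / LambdaMinus b⁻¹) = 2 * Real.log (perron (unimodularM b)) := by
  -- With `γ = b⁻¹`, the matrix with rows `(γ, γ)` and `(1, 1 + γ)` is `γ • unimodularM b`, so the
  -- discriminants differ by the factor `γ²`.
  have hs : Real.sqrt (4 * b⁻¹ + 1) = b⁻¹ * Real.sqrt ((2 + b) ^ 2 - 4) := by
    rw [show 4 * b⁻¹ + 1 = b⁻¹ ^ 2 * ((2 + b) ^ 2 - 4) by field_simp; ring,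
      Real.sqrt_mul (by positivity), Real.sqrt_sq (by positivity)]
  have hp := one_le_perron (unimodularM_nonneg hb.le) (det_unimodularM b)
  have hsq := perron_sq (unimodularM_nonneg hb.le)
  have htr : (unimodularM b).trace = 2 + b := by
    rw [Matrix.trace_fin_two]; simp [unimodularM]; ring
  rw [det_unimodularM, htr] at hsq
  have hP := perron_unimodularM b
  have h1 : LambdaPlus b⁻¹ = b⁻¹ * perron (unimodularM b) := by
    rw [LambdaPlus, hs, hP]; field_simp
  have h2 : LambdaMinus b⁻¹ = b⁻¹ * (perron (unimodularM b))⁻¹ := by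
    have : (perron (unimodularM b))⁻¹ = 2 + b - perron (unimodularM b) := by
      rw [inv_eq_iff_eq_inv]
      exact eq_inv_of_mul_eq_one_left (by linarith)
    rw [LambdaMinus, hs, this, hP]; field_simp; ring
  rw [h1, h2, show b⁻¹ * perron (unimodularM b) / (b⁻¹ * (perron (unimodularM b))⁻¹)
    = perron (unimodularM b) ^ 2 by field_simp, Real.log_pow]
  norm_num

end LambdaRatio

/-! ### Expectations under the product measure -/

section ProductMeasure

theorem integrable_pi_of_bounded {n : ℕ} (μ : Measure ℝ) [IsProbabilityMeasure μ]
    {f : (Fin n → ℝ) → ℝ} (hf : Measurable f) {a b : ℝ} (h : ∀ x, f x ∈ Set.Icc a b) :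
    Integrable f (Measure.pi fun _ => μ) :=
  Integrable.of_mem_Icc a b hf.aemeasurable (ae_of_all _ h)

variable (μ : Measure ℝ) [IsProbabilityMeasure μ]

theorem integrable_logPerron {n : ℕ} :
    Integrable (logPerron (n := n)) (Measure.pi fun _ => μ) :=
  integrable_pi_of_bounded μ measurable_logPerron fun x => ⟨logPerron_nonneg x, logPerron_le x⟩

theorem integrable_logSum {n : ℕ} : Integrable (logSum (n := n)) (Measure.pi fun _ => μ) :=
  integrable_pi_of_bounded μ measurable_logSum fun x =>
    ⟨(logPerron_nonneg x).trans (logPerron_le_logSum x),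
      (logSum_le x).trans (add_le_add_left (logPerron_le x) _)⟩

theorem integrable_normProd {n : ℕ} (i j : Fin 2) :
    Integrable (fun x : Fin n → ℝ => normProd x i j) (Measure.pi fun _ => μ) := by
  have h : ∀ x : Fin n → ℝ, normProd x i j ∈ Set.Icc 0
      (Real.exp (logPerron (fun _ : Fin n => (0 : ℝ)) + n * Real.log (4 / 3) + Real.log 6)) := by
    intro x
    refine ⟨normProd_nonneg x i j, ?_⟩
    have h1 : normProd x i j ≤ entrySum (normProd x) := by
      have := normProd_nonneg x
      rw [entrySum]
      fin_cases i <;> fin_cases j <;> simp <;> linarith [this 0 0, this 0 1, this 1 0, this 1 1]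
    refine h1.trans ?_
    rw [← Real.log_le_iff_le_exp (entrySum_normProd_pos x)]
    linarith [logSum_le x, logPerron_le x, show logSum x = Real.log (entrySum (normProd x)) from rfl]
  exact integrable_pi_of_bounded μ (measurable_normProd i j) h

theorem integrable_clampInv : Integrable clampInv μ :=
  Integrable.of_mem_Icc _ _ measurable_clampInv.aemeasurable (ae_of_all _ clampInv_mem)

theorem integral_clampInv_mem : ∫ y, clampInv y ∂μ ∈ Set.Icc (1 / 2 : ℝ) (2 / 3) := by
  have h1 := integral_mono (integrable_const (1 / 2 : ℝ)) (integrable_clampInv μ)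
    fun y => (clampInv_mem y).1
  have h2 := integral_mono (integrable_clampInv μ) (integrable_const (2 / 3 : ℝ))
    fun y => (clampInv_mem y).2
  simp only [integral_const, probReal_univ, smul_eq_mul, one_mul] at h1 h2
  exact ⟨h1, h2⟩

/-- Splitting off the first coordinate of a finite product measure. -/
theorem integral_pi_succ {n : ℕ} (F : ℝ × (Fin n → ℝ) → ℝ) :
    ∫ x : Fin (n + 1) → ℝ, F (x 0, fun i => x i.succ) ∂(Measure.pi fun _ => μ)
      = ∫ p, F p ∂(μ.prod (Measure.pi fun _ => μ)) :=
  (measurePreserving_piFinSuccAbove (fun _ : Fin (n + 1) => μ) 0).integral_comp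
    (MeasurableEquiv.piFinSuccAbove (fun _ : Fin (n + 1) => ℝ) 0).measurableEmbedding F

/-- The expectation of the product of independent matrices, applied to an eigenvector of the
expectation of one of them. -/
theorem integral_normProd_apply {r : ℝ} (hr : r ^ 2 = (2 + ∫ y, clampInv y ∂μ) * r - 1) (n : ℕ) :
    (∫ x : Fin n → ℝ, (normProd x 0 0 + normProd x 0 1 * (r - 1)) ∂(Measure.pi fun _ => μ)
      = r ^ n) ∧
    (∫ x : Fin n → ℝ, (normProd x 1 0 + normProd x 1 1 * (r - 1)) ∂(Measure.pi fun _ => μ)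
      = r ^ n * (r - 1)) := by
  induction n with
  | zero => simp [normProd_zero]
  | succ n ih =>
    set β := ∫ y, clampInv y ∂μ
    set π : Measure (Fin n → ℝ) := Measure.pi fun _ => μ
    -- The vector `(1, r - 1)` is an eigenvector of `unimodularM β` for `r`. The first factor is
    -- independent of the others, so averaging over it multiplies the mean of `v` by `unimodularM
    -- β`.
    let v : Fin 2 → (Fin n → ℝ) → ℝ := fun i x => normProd x i 0 + normProd x i 1 * (r - 1)
    have hv : ∀ i, Integrable (v i) π := fun i =>
      (integrable_normProd μ i 0).add ((integrable_normProd μ i 1).mul_const _)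
    have hc := integrable_clampInv μ
    have h0 : ∀ x : Fin (n + 1) → ℝ, normProd x 0 0 + normProd x 0 1 * (r - 1)
        = 1 * v 0 (fun i => x i.succ) + 1 * v 1 (fun i => x i.succ) := by
      intro x
      simp only [normProd_succ, Matrix.mul_apply, Fin.sum_univ_two, unimodularM, v]
      simp
      ring
    have h1 : ∀ x : Fin (n + 1) → ℝ, normProd x 1 0 + normProd x 1 1 * (r - 1)
        = clampInv (x 0) * v 0 (fun i => x i.succ)
          + (1 + clampInv (x 0)) * v 1 (fun i => x i.succ) := by
      intro x
      simp only [normProd_succ, Matrix.mul_apply, Fin.sum_univ_two, unimodularM, v]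
      simp
      ring
    have h1c : Integrable (fun y => 1 + clampInv y) μ := (integrable_const _).add hc
    have hβ : ∫ y, (1 + clampInv y) ∂μ = 1 + β := by
      rw [integral_add (integrable_const _) hc]; simp [β]
    simp only [h0, h1]
    rw [integral_pi_succ μ fun p => 1 * v 0 p.2 + 1 * v 1 p.2,
      integral_pi_succ μ fun p => clampInv p.1 * v 0 p.2 + (1 + clampInv p.1) * v 1 p.2,
      integral_add ((integrable_const (1 : ℝ)).mul_prod (hv 0))
        ((integrable_const (1 : ℝ)).mul_prod (hv 1)),
      integral_add (hc.mul_prod (hv 0)) (h1c.mul_prod (hv 1)),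
      integral_prod_mul (fun _ => (1 : ℝ)), integral_prod_mul (fun _ => (1 : ℝ)),
      integral_prod_mul, integral_prod_mul (fun y => 1 + clampInv y), hβ]
    have e0 : ∫ x, v 0 x ∂π = r ^ n := ih.1
    have e1 : ∫ x, v 1 x ∂π = r ^ n * (r - 1) := ih.2
    rw [e0, e1]
    constructor
    · simp; ring
    · linear_combination -r ^ n * hr

/-- Jensen's inequality in tangent-line form, `log s ≤ s / m + log m - 1`, with `m` of the order of
the mean entry sum. -/
theorem integral_logSum_le (n : ℕ) :
    ∫ x : Fin n → ℝ, logSum x ∂(Measure.pi fun _ => μ)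
      ≤ n * Real.log (perron (unimodularM (∫ y, clampInv y ∂μ))) + Real.log 20 := by
  have hβ := integral_clampInv_mem μ
  set β := ∫ y, clampInv y ∂μ with hβdef
  have hN := unimodularM_nonneg (b := β) (by linarith [hβ.1])
  have hr1 := one_le_perron hN (det_unimodularM β)
  have hr2 := le_perron hN 1
  have hrsq := perron_sq hN
  have htr : (unimodularM β).trace = 2 + β := by
    rw [Matrix.trace_fin_two]; simp [unimodularM]; ring
  rw [det_unimodularM, htr] at hrsq
  set r := perron (unimodularM β)
  -- The lower bound gives `r - 1 ≥ 1/2`, hence the factor 2 in `hle`; the upper bound makes `2 * r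
  -- / 20 ≤ 1` in `hfrac`.
  have hr3 : 3 / 2 ≤ r := by
    simp [unimodularM] at hr2; linarith [hβ.1]
  have hr4 : r ≤ 3 := by nlinarith [hβ.2]
  obtain ⟨h0, h1⟩ := integral_normProd_apply μ hrsq n
  let G : (Fin n → ℝ) → ℝ := fun x =>
    (normProd x 0 0 + normProd x 0 1 * (r - 1)) + (normProd x 1 0 + normProd x 1 1 * (r - 1))
  have hi : ∀ i, Integrable (fun x : Fin n → ℝ => normProd x i 0 + normProd x i 1 * (r - 1))
      (Measure.pi fun _ => μ) := fun i =>
    (integrable_normProd μ i 0).add ((integrable_normProd μ i 1).mul_const _)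
  have hG : ∫ x, G x ∂(Measure.pi fun _ => μ) = r ^ n * r := by
    simp only [G]
    rw [integral_add (hi 0) (hi 1), h0, h1]
    ring
  have hle : ∀ x : Fin n → ℝ, entrySum (normProd x) ≤ 2 * G x := by
    intro x
    have h := normProd_nonneg x
    simp only [entrySum, G]
    nlinarith [h 0 0, h 0 1, h 1 0, h 1 1, mul_nonneg (h 0 1) (sub_nonneg.2 hr3),
      mul_nonneg (h 1 1) (sub_nonneg.2 hr3)]
  set m : ℝ := r ^ n * 20 with hm
  have hmpos : 0 < m := by positivity
  have hpt : ∀ x : Fin n → ℝ, logSum x ≤ 2 / m * G x + (Real.log m - 1) := by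
    intro x
    have hp := entrySum_normProd_pos x
    have h := Real.log_le_sub_one_of_pos (div_pos hp hmpos)
    rw [Real.log_div hp.ne' hmpos.ne'] at h
    have h' : entrySum (normProd x) / m ≤ 2 / m * G x := by
      rw [div_mul_eq_mul_div]
      gcongr
      exact hle x
    have : logSum x = Real.log (entrySum (normProd x)) := rfl
    linarith
  have hGi : Integrable (fun x => 2 / m * G x) (Measure.pi fun _ : Fin n => μ) :=
    ((hi 0).add (hi 1)).const_mul _
  have hmono := integral_mono (integrable_logSum μ) (hGi.add (integrable_const (Real.log m - 1)))
    hpt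
  have hval : ∫ x, (2 / m * G x + (Real.log m - 1))
      ∂(Measure.pi fun _ : Fin n => μ) = 2 / m * (r ^ n * r) + (Real.log m - 1) := by
    rw [integral_add hGi (integrable_const _), integral_const_mul, hG]
    simp
  have hfrac : 2 / m * (r ^ n * r) ≤ 1 := by
    rw [div_mul_eq_mul_div, div_le_one hmpos, hm]
    nlinarith [pow_pos (by linarith : 0 < r) n]
  have hlogm : Real.log m = n * Real.log r + Real.log 20 := by
    rw [hm, Real.log_mul (by positivity) (by norm_num), Real.log_pow]
  linarith [hmono.trans_eq hval]

end ProductMeasure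

/-! ### Limits for the i.i.d. sequence -/

section IndependentSequence

variable {Ω : Type*} [MeasurableSpace Ω] {P : Measure Ω}
  {X : ℕ → Ω → ℝ}

/-- A block of an i.i.d. sequence is distributed according to a product measure. -/
theorem map_block_eq_pi (hmeas : ∀ i, Measurable (X i)) (hindep : iIndepFun X P)
    (hident : ∀ i, IdentDistrib (X i) (X 0) P P) (k n : ℕ) :
    P.map (fun ω (i : Fin n) => X (k + i) ω) = Measure.pi fun _ => P.map (X 0) := by
  have hinj : Function.Injective fun i : Fin n => k + (i : ℕ) := fun i j h => by
    apply Fin.ext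
    simpa using h
  have h := (hindep.precomp hinj).map_fun_eq_pi_map fun i => (hmeas _).aemeasurable
  simp only [(hident _).map_eq] at h
  exact h

theorem integral_block {n : ℕ} {f : (Fin n → ℝ) → ℝ} (hf : Measurable f)
    (hmeas : ∀ i, Measurable (X i)) (hindep : iIndepFun X P)
    (hident : ∀ i, IdentDistrib (X i) (X 0) P P) (k : ℕ) :
    ∫ ω, f (fun i => X (k + i) ω) ∂P = ∫ x, f x ∂(Measure.pi fun _ => P.map (X 0)) := by
  rw [← map_block_eq_pi hmeas hindep hident k n,
    integral_map (by fun_prop) hf.aestronglyMeasurable]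

theorem integrable_block {n : ℕ} {f : (Fin n → ℝ) → ℝ} (hmeas : ∀ i, Measurable (X i))
    (hindep : iIndepFun X P) (hident : ∀ i, IdentDistrib (X i) (X 0) P P)
    (hf : Integrable f (Measure.pi fun _ => P.map (X 0))) (k : ℕ) :
    Integrable (fun ω => f (fun i => X (k + i) ω)) P := by
  rw [← map_block_eq_pi hmeas hindep hident k n] at hf
  exact hf.comp_measurable (by fun_prop)

variable [IsProbabilityMeasure P]

theorem subadditive_integral_logSum (hmeas : ∀ i, Measurable (X i)) (hindep : iIndepFun X P)
    (hident : ∀ i, IdentDistrib (X i) (X 0) P P) :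
    Subadditive fun n => ∫ x : Fin n → ℝ, logSum x ∂(Measure.pi fun _ => P.map (X 0)) := by
  have : IsProbabilityMeasure (P.map (X 0)) :=
    Measure.isProbabilityMeasure_map (hmeas 0).aemeasurable
  intro n m
  have hi := fun k j => integrable_block (n := j) hmeas hindep hident (integrable_logSum _) k
  have he := fun k j => integral_block (n := j) measurable_logSum hmeas hindep hident k
  -- The block of length `m` starting at index `n` has the same law as the initial one.
  simp only [← he 0 (n + m), ← he 0 n, ← he n m]
  rw [← integral_add (hi 0 n) (hi n m)]
  refine integral_mono (hi 0 _) ((hi 0 n).add (hi n m)) fun ω => ?_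
  simpa using logSum_append_le (fun i => X i ω) n m

/-- The mean logarithmic growth rate of the normalized products exists and is bounded by the
growth rate for the averaged matrix. -/
theorem exists_tendsto_integral_logPerron_div (hmeas : ∀ i, Measurable (X i))
    (hindep : iIndepFun X P) (hident : ∀ i, IdentDistrib (X i) (X 0) P P) :
    ∃ l, Tendsto (fun n : ℕ => (∫ x : Fin n → ℝ, logPerron x
        ∂(Measure.pi fun _ => P.map (X 0))) / n) atTop (𝓝 l) ∧
      l ≤ Real.log (perron (unimodularM (∫ y, clampInv y ∂(P.map (X 0))))) := by
  have : IsProbabilityMeasure (P.map (X 0)) :=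
    Measure.isProbabilityMeasure_map (hmeas 0).aemeasurable
  set μ := P.map (X 0)
  set a : ℕ → ℝ := fun n => ∫ x : Fin n → ℝ, logSum x ∂(Measure.pi fun _ => μ)
  set p : ℕ → ℝ := fun n => ∫ x : Fin n → ℝ, logPerron x ∂(Measure.pi fun _ => μ)
  have hsub : Subadditive a := subadditive_integral_logSum hmeas hindep hident
  have hpa : ∀ n, p n ≤ a n := fun n =>
    integral_mono (integrable_logPerron μ) (integrable_logSum μ) logPerron_le_logSum
  have hap : ∀ n, a n ≤ p n + Real.log 6 := by
    intro n
    have := integral_mono (integrable_logSum μ)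
      ((integrable_logPerron μ).add (integrable_const (Real.log 6))) (logSum_le (n := n))
    simp only [Pi.add_apply] at this
    rw [integral_add (integrable_logPerron μ) (integrable_const _)] at this
    simpa using this
  have hp0 : ∀ n, 0 ≤ p n := fun n => integral_nonneg logPerron_nonneg
  have hbdd : BddBelow (Set.range fun n => a n / n) := by
    refine ⟨0, ?_⟩
    rintro _ ⟨n, rfl⟩
    exact div_nonneg ((hp0 n).trans (hpa n)) n.cast_nonneg
  have ha := hsub.tendsto_lim hbdd
  have hconst : ∀ c : ℝ, Tendsto (fun n : ℕ => c / n) atTop (𝓝 0) :=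
    tendsto_const_div_atTop_nhds_zero_nat
  -- `p` and `a` differ by at most `log 6`, so Fekete's limit for `a` is also that of `p`.
  have hp : Tendsto (fun n : ℕ => p n / n) atTop (𝓝 hsub.lim) := by
    refine tendsto_of_tendsto_of_tendsto_of_le_of_le
      (by simpa using ha.sub (hconst (Real.log 6))) ha (fun n => ?_) fun n => ?_
    · rw [← sub_div]
      exact div_le_div_of_nonneg_right (by linarith [hap n]) n.cast_nonneg
    · exact div_le_div_of_nonneg_right (hpa n) n.cast_nonneg
  refine ⟨_, hp, ?_⟩
  set R := Real.log (perron (unimodularM (∫ y, clampInv y ∂μ)))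
  have hR : Tendsto (fun n : ℕ => R + Real.log 20 / n) atTop (𝓝 R) := by
    simpa using (hconst (Real.log 20)).const_add R
  refine le_of_tendsto_of_tendsto ha hR ?_
  filter_upwards [eventually_gt_atTop 0] with n hn
  have hn' : (0 : ℝ) < n := by exact_mod_cast hn
  rw [div_le_iff₀ hn', add_mul, div_mul_cancel₀ _ hn'.ne', mul_comm R]
  exact integral_logSum_le μ n

/-- Sub-Gaussian concentration of the Perron root of the normalized products. -/
theorem hasSubgaussianMGF_logPerron (hmeas : ∀ i, Measurable (X i)) (hindep : iIndepFun X P)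
    (hident : ∀ i, IdentDistrib (X i) (X 0) P P) (n : ℕ) :
    HasSubgaussianMGF (fun ω => logPerron (fun i : Fin n => X i ω)
      - ∫ x : Fin n → ℝ, logPerron x ∂(Measure.pi fun _ => P.map (X 0)))
      (n * (Real.log (4 / 3)).toNNReal ^ 2) P := by
  have : IsProbabilityMeasure (P.map (X 0)) :=
    Measure.isProbabilityMeasure_map (hmeas 0).aemeasurable
  have h := hasSubgaussianMGF_of_boundedDifferences (P.map (X 0))
    (c := (Real.log (4 / 3)).toNNReal) (n := n) measurable_logPerron (fun x k y => by
      rw [Real.coe_toNNReal _ (Real.log_nonneg (by norm_num))]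
      exact abs_logPerron_update_sub_le x k y)
  have hm := map_block_eq_pi hmeas hindep hident 0 n
  simp only [zero_add] at hm
  rw [← hm] at h ⊢
  exact h.of_map (by fun_prop)

/-- Almost sure convergence from exponential tail bounds, by Borel–Cantelli. -/
theorem ae_tendsto_zero_of_tail_le {Z : ℕ → Ω → ℝ} {C : ℝ} (hC : 0 < C)
    (h : ∀ n : ℕ, 1 ≤ n → ∀ ε : ℝ, 0 < ε →
      P.real {ω | Z n ω > ε} ≤ Real.exp (-C * ε ^ 2 * n) ∧
      P.real {ω | Z n ω < -ε} ≤ Real.exp (-C * ε ^ 2 * n)) :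
    ∀ᵐ ω ∂P, Tendsto (fun n => Z n ω) atTop (𝓝 0) := by
  have key : ∀ k : ℕ, ∀ᵐ ω ∂P, ∀ᶠ n in atTop, |Z n ω| ≤ 1 / ((k : ℝ) + 1) := by
    intro k
    have hε : 0 < 1 / ((k : ℝ) + 1) := by positivity
    set ε := 1 / ((k : ℝ) + 1)
    -- The index is shifted because the tail bounds start at `n = 1`.
    have hbound : ∀ n, P.real {ω | ε < |Z (n + 1) ω|}
        ≤ 2 * Real.exp (-(C * ε ^ 2)) ^ (n + 1) := by
      intro n
      have hsub : {ω | ε < |Z (n + 1) ω|} ⊆ {ω | Z (n + 1) ω > ε} ∪ {ω | Z (n + 1) ω < -ε} := by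
        intro ω hω
        rcases lt_abs.1 (show ε < |Z (n + 1) ω| from hω) with h | h
        · exact Or.inl h
        · exact Or.inr (show Z (n + 1) ω < -ε by linarith)
      have h12 := h (n + 1) (by omega) ε hε
      have e : Real.exp (-C * ε ^ 2 * (n + 1 : ℕ)) = Real.exp (-(C * ε ^ 2)) ^ (n + 1) := by
        rw [← Real.exp_nat_mul]; congr 1; ring
      rw [e] at h12
      linarith [(measureReal_mono hsub).trans (measureReal_union_le (μ := P) _ _), h12.1, h12.2]
    have hsum : Summable fun n => P.real {ω | ε < |Z (n + 1) ω|} := by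
      refine Summable.of_nonneg_of_le (fun _ => measureReal_nonneg) hbound ?_
      refine Summable.mul_left 2 ((summable_nat_add_iff 1).2 ?_)
      refine summable_geometric_of_lt_one (Real.exp_pos _).le (Real.exp_lt_one_iff.2 ?_)
      have : 0 < C * ε ^ 2 := by positivity
      linarith
    have hfin : ∑' n, P {ω | ε < |Z (n + 1) ω|} ≠ ⊤ := by
      convert hsum.tsum_ofReal_ne_top using 4
      exact (ofReal_measureReal).symm
    filter_upwards [ae_eventually_notMem hfin] with ω hω
    rw [← map_add_atTop_eq_nat 1, eventually_map]
    filter_upwards [hω] with n hn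
    exact not_lt.1 hn
  filter_upwards [ae_all_iff.2 key] with ω hω
  rw [Metric.tendsto_atTop]
  intro δ hδ
  obtain ⟨k, hk⟩ := exists_nat_one_div_lt hδ
  obtain ⟨N, hN⟩ := eventually_atTop.1 (hω k)
  refine ⟨N, fun n hn => ?_⟩
  rw [Real.dist_eq, sub_zero]
  exact (hN n hn).trans_lt hk

end IndependentSequence

end TransferMatrix

/-! ### The main theorem -/

theorem mainTheorem3 {Ω : Type*} [MeasurableSpace Ω] (P : Measure Ω) [IsProbabilityMeasure P]
    (X : ℕ → Ω → ℝ) (hmeas : ∀ i, Measurable (X i)) (hindep : iIndepFun X P)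
    (hident : ∀ i, IdentDistrib (X i) (X 0) P P)
    (hsupp : ∀ᵐ ω ∂P, X 0 ω ∈ Set.Icc (1 / 2 : ℝ) 1) :
    -- the extreme eigenvalues exist and are positive, and `Y_n` is integrable
    (∀ᵐ ω ∂P, ∀ n : ℕ,
      IsGreatest (spectrum ℝ (TransferMatrix.prodM (fun i => X i ω) n))
        (TransferMatrix.eigMax (TransferMatrix.prodM (fun i => X i ω) n)) ∧
      IsLeast (spectrum ℝ (TransferMatrix.prodM (fun i => X i ω) n))
        (TransferMatrix.eigMin (TransferMatrix.prodM (fun i => X i ω) n)) ∧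
      0 < TransferMatrix.eigMin (TransferMatrix.prodM (fun i => X i ω) n)) ∧
    (∀ n : ℕ, Integrable (fun ω => TransferMatrix.Y (fun i => X i ω) n) P) ∧
    -- concentration
    (∃ C : ℝ, 0 < C ∧ ∀ n : ℕ, 1 ≤ n → ∀ ε : ℝ, 0 < ε →
      P.real {ω | TransferMatrix.Y (fun i => X i ω) n
          - ∫ ω', TransferMatrix.Y (fun i => X i ω') n ∂P > ε}
        ≤ Real.exp (-C * ε ^ 2 * n) ∧
      P.real {ω | TransferMatrix.Y (fun i => X i ω) n
          - ∫ ω', TransferMatrix.Y (fun i => X i ω') n ∂P < -ε}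
        ≤ Real.exp (-C * ε ^ 2 * n)) ∧
    -- the almost sure, constant limits, their sum, and the bound on their difference
    (∃ Lplus Lminus : ℝ,
      (∀ᵐ ω ∂P, Tendsto (fun n : ℕ => (1 / (n : ℝ)) *
        Real.log (TransferMatrix.eigMax (TransferMatrix.prodM (fun i => X i ω) n)))
        atTop (𝓝 Lplus)) ∧
      (∀ᵐ ω ∂P, Tendsto (fun n : ℕ => (1 / (n : ℝ)) *
        Real.log (TransferMatrix.eigMin (TransferMatrix.prodM (fun i => X i ω) n)))
        atTop (𝓝 Lminus)) ∧
      Integrable (fun ω => Real.log (1 + X 0 ω)) P ∧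
      Lplus + Lminus = 2 * ∫ ω, Real.log (1 + X 0 ω) ∂P ∧
      (∀ᵐ ω ∂P, Tendsto (fun n : ℕ => TransferMatrix.Y (fun i => X i ω) n)
        atTop (𝓝 (Lplus - Lminus))) ∧
      Tendsto (fun n : ℕ => ∫ ω, TransferMatrix.Y (fun i => X i ω) n ∂P)
        atTop (𝓝 (Lplus - Lminus)) ∧
      Integrable (fun ω => (1 + X 0 ω)⁻¹) P ∧
      (∫ ω, (1 + X 0 ω)⁻¹ ∂P)⁻¹ ∈ Set.Icc (3 / 2 : ℝ) 2 ∧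
      Lplus - Lminus ≤
        Real.log (TransferMatrix.LambdaPlus ((∫ ω, (1 + X 0 ω)⁻¹ ∂P)⁻¹) /
          TransferMatrix.LambdaMinus ((∫ ω, (1 + X 0 ω)⁻¹ ∂P)⁻¹))) := by
  have hsuppi : ∀ i, ∀ᵐ ω ∂P, X i ω ∈ Set.Icc (1 / 2 : ℝ) 1 := fun i =>
    (hident i).symm.ae_mem_snd measurableSet_Icc hsupp
  have hall : ∀ᵐ ω ∂P, ∀ i, X i ω ∈ Set.Icc (1 / 2 : ℝ) 1 := ae_all_iff.2 hsuppi
  set μ := P.map (X 0) with hμ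
  have : IsProbabilityMeasure μ := Measure.isProbabilityMeasure_map (hmeas 0).aemeasurable
  set p : ℕ → ℝ := fun n => ∫ x : Fin n → ℝ, TransferMatrix.logPerron x
    ∂(Measure.pi fun _ => μ)
  have hYae : ∀ n : ℕ, (fun ω => TransferMatrix.Y (fun i => X i ω) n)
      =ᵐ[P] fun ω => 2 / n * TransferMatrix.logPerron fun i : Fin n => X i ω := by
    intro n
    filter_upwards [hall] with ω hω using TransferMatrix.Y_eq hω n
  have hlpi : ∀ n : ℕ, Integrable (fun ω => TransferMatrix.logPerron fun i : Fin n => X i ω) P := by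
    intro n
    simpa using TransferMatrix.integrable_block hmeas hindep hident
      (TransferMatrix.integrable_logPerron μ (n := n)) 0
  have hmean : ∀ n : ℕ, ∫ ω, TransferMatrix.Y (fun i => X i ω) n ∂P = 2 / n * p n := by
    intro n
    rw [integral_congr_ae (hYae n), integral_const_mul]
    congr 1
    simpa using TransferMatrix.integral_block (n := n) TransferMatrix.measurable_logPerron
      hmeas hindep hident 0
  have hc : 0 < Real.log (4 / 3) := Real.log_pos (by norm_num)
  -- A deviation `ε` of `Y_n` is a deviation `n ε / 2` of `log ρ`, whose variance proxy is `n c²`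
  -- with `c = log (4/3)`; the exponent is `(n ε / 2)² / (2 n c²) = n ε² / (8 c²)`.
  set C : ℝ := 1 / (8 * Real.log (4 / 3) ^ 2) with hC
  have hCpos : 0 < C := by positivity
  have hconc : ∀ n : ℕ, 1 ≤ n → ∀ ε : ℝ, 0 < ε →
      P.real {ω | TransferMatrix.Y (fun i => X i ω) n
          - ∫ ω', TransferMatrix.Y (fun i => X i ω') n ∂P > ε}
        ≤ Real.exp (-C * ε ^ 2 * n) ∧
      P.real {ω | TransferMatrix.Y (fun i => X i ω) n
          - ∫ ω', TransferMatrix.Y (fun i => X i ω') n ∂P < -ε}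
        ≤ Real.exp (-C * ε ^ 2 * n) := by
    intro n hn ε hε
    have hn' : (0 : ℝ) < n := by exact_mod_cast hn
    have hsub := TransferMatrix.hasSubgaussianMGF_logPerron hmeas hindep hident n
    have h0 : 0 ≤ n * ε / 2 := by positivity
    have hexp : -(n * ε / 2) ^ 2 / (2 * (((n : NNReal) * (Real.log (4 / 3)).toNNReal ^ 2 : NNReal)
        : ℝ)) = -C * ε ^ 2 * n := by
      push_cast
      rw [Real.coe_toNNReal _ hc.le, hC]
      field_simp
      ring
    have hup := hsub.measure_ge_le h0
    have hlo := hsub.neg.measure_ge_le h0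
    rw [hexp] at hup hlo
    have hscale : ∀ a : ℝ, 2 / (n : ℝ) * a = a / (n / 2) := fun a => by field_simp
    constructor
    · refine le_trans (ENNReal.toReal_mono (measure_ne_top _ _) (measure_mono_ae ?_)) hup
      filter_upwards [hYae n] with ω hω h
      change ε < _ at h
      change n * ε / 2 ≤ _ - p n
      rw [hω, hmean, ← mul_sub, hscale, lt_div_iff₀ (by positivity)] at h
      linarith
    · refine le_trans (ENNReal.toReal_mono (measure_ne_top _ _) (measure_mono_ae ?_)) hlo
      filter_upwards [hYae n] with ω hω h
      change _ < -ε at h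
      change n * ε / 2 ≤ -(_ - p n)
      rw [hω, hmean, ← mul_sub, hscale, div_lt_iff₀ (by positivity)] at h
      linarith
  obtain ⟨l, hl, hle⟩ :=
    TransferMatrix.exists_tendsto_integral_logPerron_div hmeas hindep hident
  have hEY : Tendsto (fun n : ℕ => ∫ ω, TransferMatrix.Y (fun i => X i ω) n ∂P)
      atTop (𝓝 (2 * l)) := by
    refine (hl.const_mul 2).congr fun n => ?_
    rw [hmean]
    ring
  have hYlim : ∀ᵐ ω ∂P, Tendsto (fun n : ℕ => TransferMatrix.Y (fun i => X i ω) n)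
      atTop (𝓝 (2 * l)) := by
    filter_upwards [TransferMatrix.ae_tendsto_zero_of_tail_le hCpos hconc] with ω hω
    simpa using hω.add hEY
  have hlogm : Measurable fun x : ℝ => Real.log (1 + x) := by fun_prop
  have hlogi : Integrable (fun ω => Real.log (1 + X 0 ω)) P := by
    refine Integrable.of_mem_Icc 0 1 (hlogm.comp (hmeas 0)).aemeasurable ?_
    filter_upwards [hsupp] with ω hω
    refine ⟨Real.log_nonneg (by linarith [hω.1]), ?_⟩
    linarith [Real.log_le_sub_one_of_pos (show 0 < 1 + X 0 ω by linarith [hω.1]), hω.2]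
  have hslln : ∀ᵐ ω ∂P, Tendsto (fun n : ℕ => (1 / (n : ℝ)) *
      ∑ i ∈ Finset.range n, Real.log (1 + X i ω)) atTop
      (𝓝 (∫ ω, Real.log (1 + X 0 ω) ∂P)) := by
    have h := strong_law_ae (fun i ω => Real.log (1 + X i ω)) hlogi
      (fun i j hij => (hindep.indepFun hij).comp hlogm hlogm)
      (fun i => (hident i).comp hlogm)
    simpa only [smul_eq_mul, one_div] using h
  have hbae : (fun ω => (1 + X 0 ω)⁻¹) =ᵐ[P] fun ω => TransferMatrix.clampInv (X 0 ω) := by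
    filter_upwards [hsupp] with ω hω using (TransferMatrix.clampInv_of_mem hω).symm
  have hb : ∫ ω, (1 + X 0 ω)⁻¹ ∂P = ∫ y, TransferMatrix.clampInv y ∂μ := by
    rw [integral_congr_ae hbae, hμ, integral_map (hmeas 0).aemeasurable
      TransferMatrix.measurable_clampInv.aestronglyMeasurable]
  have hbi : Integrable (fun ω => (1 + X 0 ω)⁻¹) P :=
    ((TransferMatrix.integrable_clampInv μ).comp_measurable (hmeas 0)).congr hbae.symm
  have hbmem := TransferMatrix.integral_clampInv_mem μ
  set E := ∫ ω, Real.log (1 + X 0 ω) ∂P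
  have hdiff : (E + l) - (E - l) = 2 * l := by ring
  refine ⟨?_, fun n => ((hlpi n).const_mul _).congr (hYae n).symm, ⟨C, hCpos, hconc⟩,
    E + l, E - l, ?_, ?_, hlogi, by ring, by rwa [hdiff], by rwa [hdiff], hbi, ?_, ?_⟩
  · filter_upwards [hall] with ω hω n
    have h1 := TransferMatrix.isGreatest_spectrum_prodM hω n
    have h2 := TransferMatrix.isLeast_spectrum_prodM hω n
    rw [TransferMatrix.eigMax_prodM hω, TransferMatrix.eigMin_prodM hω]
    refine ⟨h1, h2, mul_pos (TransferMatrix.prod_one_add_pos hω n) (inv_pos.2 ?_)⟩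
    linarith [TransferMatrix.one_le_perron_normProd fun i : Fin n => X i ω]
  · filter_upwards [hall, hslln, hYlim] with ω hω h1 h2
    -- `(1 / n) log λ₊` is the empirical mean of `log (1 + x i)` plus `Y_n / 2`; for `λ₋` the sign
    -- changes.
    have h3 := h1.add (h2.const_mul (1 / 2))
    rw [show E + 1 / 2 * (2 * l) = E + l by ring] at h3
    refine h3.congr fun n => ?_
    rw [TransferMatrix.log_eigMax_prodM hω, TransferMatrix.Y_eq hω]
    ring
  · filter_upwards [hall, hslln, hYlim] with ω hω h1 h2
    have h3 := h1.sub (h2.const_mul (1 / 2))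
    rw [show E - 1 / 2 * (2 * l) = E - l by ring] at h3
    refine h3.congr fun n => ?_
    rw [TransferMatrix.log_eigMin_prodM hω, TransferMatrix.Y_eq hω]
    ring
  · rw [hb]
    have hpos : 0 < ∫ y, TransferMatrix.clampInv y ∂μ := by linarith [hbmem.1]
    constructor
    · rw [le_inv_comm₀ (by norm_num) hpos]
      linarith [hbmem.2]
    · rw [inv_le_comm₀ hpos (by norm_num)]
      linarith [hbmem.1]
  · rw [hdiff, hb, TransferMatrix.log_LambdaPlus_div_LambdaMinus (by linarith [hbmem.1])]
    linarith
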